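/- Let $d\ge 1$ and let $\mathcal X\subset\mathbb R^d$ be a compact set with $\mathrm{span}(\mathcal X)=\mathbb R^d$. For a probability distribution $\lambda$ on $\mathcal X$ put $A(\lambda)=\mathbb E_{x\sim\lambda}[xx^\top]$, and define the Gaussian width $$w(\mathcal X)=\inf_{\lambda}\ \mathbb E_{\eta\sim\mathcal N(0,I_d)}\Big[\max_{x\in\mathcal X}\big\langle x,A(\lambda)^{-1/2}\eta\big\rangle\Big],$$ where the infimum is over all probability distributions $\lambda$ on $\mathcal X$ for which $A(\lambda)$ is positive definite. There are absolute constants $c,C,C'>0$ (independent of $d$ and $\mathcal X$) such that for all such $d$ and $\mathcal X$ $$c\,\sqrt{d\log d}\ \le\ w(\mathcal X)\ \le\ C\,d,$$ and, if $\mathcal X$ is finite, also $w(\mathcal X)\le C'\sqrt{d\log|\mathcal X|}$. -/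

import Mathlib

open MeasureTheory ProbabilityTheory
open scoped MatrixOrder

noncomputable section

/-- The design matrix `A(μ) = 𝔼_{x ∼ μ}[x xᵀ]` of a measure `μ` on `ℝ^d`. -/
def designMatrix {d : ℕ} (μ : Measure (EuclideanSpace ℝ (Fin d))) : Matrix (Fin d) (Fin d) ℝ :=
  Matrix.of fun i j => ∫ x, x i * x j ∂μ

/-- The operator `A^{-1/2}` on `ℝ^d`, where `A^{1/2}` is the positive semidefinite square root.
It is used below only for positive definite `A`. -/
def invSqrt {d : ℕ} (A : Matrix (Fin d) (Fin d) ℝ) :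
    EuclideanSpace ℝ (Fin d) →L[ℝ] EuclideanSpace ℝ (Fin d) :=
  Matrix.toEuclideanCLM (𝕜 := ℝ) ((CFC.sqrt A)⁻¹)

/-- `supProcess X A g = sup_{x ∈ X} ⟨x, A^{-1/2} g⟩`; for nonempty compact `X` it is a maximum. -/
def supProcess {d : ℕ} (X : Set (EuclideanSpace ℝ (Fin d))) (A : Matrix (Fin d) (Fin d) ℝ)
    (g : EuclideanSpace ℝ (Fin d)) : ℝ :=
  ⨆ x : X, inner ℝ (x : EuclideanSpace ℝ (Fin d)) (invSqrt A g)

/-- The Gaussian width at a fixed matrix: `𝔼_{g ∼ N(0, I_d)} [sup_{x ∈ X} ⟨x, A^{-1/2} g⟩]`. -/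
def gaussianWidthAt {d : ℕ} (X : Set (EuclideanSpace ℝ (Fin d)))
    (A : Matrix (Fin d) (Fin d) ℝ) : ℝ :=
  ∫ g, supProcess X A g ∂(stdGaussian (EuclideanSpace ℝ (Fin d)))

/-- The probability distributions on `X` whose design matrix is positive definite, so that
`A(μ)^{-1/2}` makes sense. -/
def nonsingularDesigns {d : ℕ} (X : Set (EuclideanSpace ℝ (Fin d))) :
    Set (Measure (EuclideanSpace ℝ (Fin d))) :=
  {μ | IsProbabilityMeasure μ ∧ (∀ᵐ x ∂μ, x ∈ X) ∧ (designMatrix μ).PosDef}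

/-- The Gaussian width `w(X) = inf_μ 𝔼_g [sup_{x ∈ X} ⟨x, A(μ)^{-1/2} g⟩]`. The infimum is taken in
the extended reals, so that it would be `+∞` if there were no admissible design: a distribution with
singular design matrix counts as having value `+∞`. -/
def gaussianWidth {d : ℕ} (X : Set (EuclideanSpace ℝ (Fin d))) : EReal :=
  ⨅ μ ∈ nonsingularDesigns X, ((gaussianWidthAt X (designMatrix μ) : ℝ) : EReal)

/-- For compact `X` the supremum is over a bounded family. -/
theorem bddAbove_supProcess {d : ℕ} {X : Set (EuclideanSpace ℝ (Fin d))} (hX : IsCompact X)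
    (A : Matrix (Fin d) (Fin d) ℝ) (g : EuclideanSpace ℝ (Fin d)) :
    BddAbove (Set.range fun x : X =>
      inner ℝ (x : EuclideanSpace ℝ (Fin d)) (invSqrt A g)) := by
  have h := (hX.image (f := fun x => inner ℝ x (invSqrt A g)) (by fun_prop)).bddAbove
  rwa [Set.image_eq_range] at h

/-- For nonempty compact `X` the expectation in `gaussianWidthAt` is that of an integrable
function. -/
theorem integrable_supProcess {d : ℕ} {X : Set (EuclideanSpace ℝ (Fin d))} (hX : IsCompact X)
    (hne : X.Nonempty) (A : Matrix (Fin d) (Fin d) ℝ) :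
    Integrable (supProcess X A) (stdGaussian (EuclideanSpace ℝ (Fin d))) := by
  have : Nonempty X := hne.to_subtype
  obtain ⟨R, hR⟩ := hX.isBounded.exists_norm_le
  have hR0 : 0 ≤ R := (norm_nonneg _).trans (hR _ hne.some_mem)
  have key : ∀ g h, supProcess X A g ≤ supProcess X A h + R * ‖invSqrt A‖ * ‖g - h‖ := by
    intro g h
    refine ciSup_le fun x => ?_
    have h1 : inner ℝ (x : EuclideanSpace ℝ (Fin d)) (invSqrt A h) ≤ supProcess X A h :=
      le_ciSup (bddAbove_supProcess hX A h) x
    have h2 : inner ℝ (x : EuclideanSpace ℝ (Fin d)) (invSqrt A (g - h)) ≤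
        R * (‖invSqrt A‖ * ‖g - h‖) :=
      (real_inner_le_norm _ _).trans
        (mul_le_mul (hR _ x.2) ((invSqrt A).le_opNorm _) (norm_nonneg _) hR0)
    rw [map_sub, inner_sub_right] at h2
    linarith
  have hL : LipschitzWith (R * ‖invSqrt A‖).toNNReal (supProcess X A) := by
    refine LipschitzWith.of_le_add_mul _ fun g h => ?_
    rw [Real.coe_toNNReal _ (by positivity), dist_eq_norm]
    exact key g h
  have h0 : supProcess X A 0 = 0 := by simp [supProcess]
  have hid : Integrable (fun g => g) (stdGaussian (EuclideanSpace ℝ (Fin d))) :=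
    IsGaussian.integrable_id
  refine (hid.norm.const_mul (R * ‖invSqrt A‖)).mono' hL.continuous.aestronglyMeasurable
    (Filter.Eventually.of_forall fun g => ?_)
  have h1 := key g 0
  have h2 := key 0 g
  simp only [h0, sub_zero, zero_sub, norm_neg] at h1 h2
  rw [Real.norm_eq_abs, abs_le]
  constructor <;> linarith

end

/-! ### Design matrices and approximately optimal designs -/

section Designs

variable {d : ℕ} {X : Set (EuclideanSpace ℝ (Fin d))} {μ : Measure (EuclideanSpace ℝ (Fin d))}

/-! Upper bounds. Take a design whose determinant is more than half the supremum; such a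
near-maximizer suffices, so attainment is not needed. Moving a little mass to a point `x` cannot
double the determinant, and the matrix determinant lemma turns this into `‖A^{-1/2} x‖² ≤ 8d` on `X`
(`exists_design_forall_dotProduct_inv_le`, a weak Kiefer–Wolfowitz theorem). Cauchy–Schwarz with
`𝔼‖g‖² = d` then gives `√8 d`, and the exponential-moment bound for finitely many Gaussians gives `5
√(d log |X|)`.

Lower bound. For every design the vectors `y = A^{-1/2} x` are isotropic, so each subspace `V`
admits a point with `‖P_V y‖² ≥ dim V`. Choosing greedily yields orthonormal `e_i` and points `y_i`
with `⟨y_i, e_i⟩ ≥ √(d - 1 - i)`, but no control of the other `⟨y_i, e_j⟩`. A stopping rule removes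
those: read the coordinates `z_i = ⟨e_i, g⟩` in order, stop at the first with `|z_i| ≥ t`, and
select `y_i` if `z_i ≥ t`, a fixed `y₀` otherwise. Earlier coordinates enter only through symmetric
conditions and later ones are independent, so all cross terms average to zero
(`le_integral_of_inner_le`). With `t = √(log d)` and `d / 2` steps the rule stops with probability
bounded below, which gives order `√d · √(log d)`. -/

theorem integrable_of_ae_mem_isCompact [IsFiniteMeasure μ] (hX : IsCompact X)
    (hμ : ∀ᵐ x ∂μ, x ∈ X) {f : EuclideanSpace ℝ (Fin d) → ℝ} (hf : Continuous f) :
    Integrable f μ := by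
  obtain ⟨R, hR⟩ := (hX.image hf).isBounded.exists_norm_le
  refine Integrable.of_bound hf.aestronglyMeasurable R ?_
  filter_upwards [hμ] with x hx using hR _ ⟨x, hx, rfl⟩

/-- The quadratic form of the design matrix is the second moment of a linear functional. -/
theorem inner_designMatrix [IsFiniteMeasure μ] (hX : IsCompact X) (hμ : ∀ᵐ x ∂μ, x ∈ X)
    (u v : EuclideanSpace ℝ (Fin d)) :
    inner ℝ u (Matrix.toEuclideanCLM (𝕜 := ℝ) (designMatrix μ) v) =
      ∫ x, inner ℝ u x * inner ℝ v x ∂μ := by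
  have hint : ∀ i j : Fin d, Integrable (fun x : EuclideanSpace ℝ (Fin d) => x i * x j) μ :=
    fun i j => integrable_of_ae_mem_isCompact hX hμ (by fun_prop)
  have h1 : ∀ x : EuclideanSpace ℝ (Fin d), inner ℝ u x * inner ℝ v x =
      ∑ i, ∑ j, u i * v j * (x i * x j) := fun x => by
    simp only [PiLp.inner_apply, RCLike.inner_apply, conj_trivial, Finset.sum_mul_sum]
    exact Finset.sum_congr rfl fun i _ => Finset.sum_congr rfl fun j _ => by ring
  simp_rw [h1]
  rw [integral_finsetSum _ fun i _ => integrable_finsetSum _ fun j _ => (hint i j).const_mul _]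
  simp_rw [integral_finsetSum _ fun j _ => (hint _ j).const_mul _, integral_const_mul]
  rw [Matrix.inner_toEuclideanCLM]
  simp only [dotProduct, Matrix.mulVec, designMatrix, Matrix.of_apply, Finset.mul_sum]
  exact Finset.sum_congr rfl fun i _ => Finset.sum_congr rfl fun j _ => by ring

theorem isHermitian_designMatrix : (designMatrix μ).IsHermitian := by
  ext i j
  simp [designMatrix, mul_comm]

theorem posSemidef_designMatrix [IsFiniteMeasure μ] (hX : IsCompact X) (hμ : ∀ᵐ x ∂μ, x ∈ X) :
    (designMatrix μ).PosSemidef := by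
  refine Matrix.PosSemidef.of_dotProduct_mulVec_nonneg isHermitian_designMatrix fun u => ?_
  have h := inner_designMatrix hX hμ (WithLp.toLp 2 u) (WithLp.toLp 2 u)
  rw [Matrix.inner_toEuclideanCLM] at h
  simp only [star_trivial]
  rw [h]
  exact integral_nonneg fun x => mul_self_nonneg _

theorem posDef_designMatrix_iff [IsFiniteMeasure μ] (hX : IsCompact X) (hμ : ∀ᵐ x ∂μ, x ∈ X) :
    (designMatrix μ).PosDef ↔ 0 < (designMatrix μ).det := by
  refine ⟨fun h => h.det_pos, fun h => ?_⟩
  exact (posSemidef_designMatrix hX hμ).posDef_iff_isUnit.2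
    ((Matrix.isUnit_iff_isUnit_det _).2 h.ne'.isUnit)

theorem designMatrix_mix [IsFiniteMeasure μ] (hX : IsCompact X) (hμ : ∀ᵐ x ∂μ, x ∈ X)
    (x : EuclideanSpace ℝ (Fin d)) {s : ℝ} (hs : 0 ≤ s) (hs1 : s ≤ 1) :
    designMatrix ((1 - s).toNNReal • μ + s.toNNReal • Measure.dirac x) =
      (1 - s) • designMatrix μ + Matrix.vecMulVec (s • x.ofLp) x.ofLp := by
  ext i j
  have hint : Integrable (fun x : EuclideanSpace ℝ (Fin d) => x i * x j) μ :=
    integrable_of_ae_mem_isCompact hX hμ (by fun_prop)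
  have hint2 : Integrable (fun x : EuclideanSpace ℝ (Fin d) => x i * x j) (Measure.dirac x) :=
    integrable_dirac (by simp [ENNReal.mul_lt_top])
  simp only [designMatrix, Matrix.of_apply, Matrix.add_apply, Matrix.smul_apply, smul_eq_mul,
    Matrix.vecMulVec_apply, Pi.smul_apply]
  rw [integral_add_measure (hint.smul_measure_nnreal) (hint2.smul_measure_nnreal),
    integral_smul_nnreal_measure, integral_smul_nnreal_measure, integral_dirac]
  simp only [NNReal.smul_def, smul_eq_mul, Real.coe_toNNReal _ hs,
    Real.coe_toNNReal _ (sub_nonneg.2 hs1)]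
  ring

theorem isProbabilityMeasure_mix [IsProbabilityMeasure μ]
    (x : EuclideanSpace ℝ (Fin d)) {s : ℝ} (hs : 0 ≤ s) (hs1 : s ≤ 1) :
    IsProbabilityMeasure ((1 - s).toNNReal • μ + s.toNNReal • Measure.dirac x) := by
  constructor
  simp only [Measure.coe_add, Pi.add_apply, Measure.smul_apply, measure_univ]
  simp only [ENNReal.smul_def, smul_eq_mul, mul_one]
  rw [← ENNReal.coe_add, ← Real.toNNReal_add (sub_nonneg.2 hs1) hs]
  simp

theorem ae_mem_mix (hμ : ∀ᵐ x ∂μ, x ∈ X) (hX : MeasurableSet X) {x : EuclideanSpace ℝ (Fin d)}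
    (hx : x ∈ X) (a b : NNReal) : ∀ᵐ y ∂(a • μ + b • Measure.dirac x), y ∈ X := by
  rw [ae_add_measure_iff]
  refine ⟨Measure.ae_smul_measure hμ a, Measure.ae_smul_measure ?_ b⟩
  exact (ae_dirac_iff hX).2 hx

theorem exists_det_designMatrix_le (hX : IsCompact X) : ∃ K : ℝ, ∀ μ : Measure _,
    IsProbabilityMeasure μ → (∀ᵐ x ∂μ, x ∈ X) → (designMatrix μ).det ≤ K := by
  obtain ⟨R, hR⟩ := hX.isBounded.exists_norm_le
  refine ⟨_, fun μ hp hμ => (le_abs_self _).trans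
    (Matrix.det_le (abv := AbsoluteValue.abs) (x := R ^ 2) fun i j => ?_)⟩
  have h : ‖∫ x, x i * x j ∂μ‖ ≤ R ^ 2 * μ.real Set.univ := by
    refine norm_integral_le_of_norm_le_const ?_
    filter_upwards [hμ] with x hx
    rw [norm_mul, sq]
    exact mul_le_mul ((PiLp.norm_apply_le x i).trans (hR x hx))
      ((PiLp.norm_apply_le x j).trans (hR x hx)) (norm_nonneg _) ((norm_nonneg _).trans (hR x hx))
  simpa [designMatrix] using h

/-- A compact spanning set carries a design with positive definite design matrix. -/
theorem nonempty_nonsingularDesigns (hd : 1 ≤ d) (hX : IsCompact X)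
    (hspan : Submodule.span ℝ X = ⊤) : (nonsingularDesigns X).Nonempty := by
  obtain ⟨f, hf, hfs, -⟩ := Submodule.exists_fun_fin_finrank_span_eq ℝ X
  have hn : Module.finrank ℝ (Submodule.span ℝ X) = d := by rw [hspan]; simp
  have : Nonempty (Fin (Module.finrank ℝ (Submodule.span ℝ X))) := ⟨⟨0, by omega⟩⟩
  set ν : Measure (Fin (Module.finrank ℝ (Submodule.span ℝ X))) := uniformOn Set.univ with hν
  have hνp : IsProbabilityMeasure ν := by
    rw [hν]; exact isProbabilityMeasure_uniformOn Set.finite_univ Set.univ_nonempty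
  have hfm : Measurable f := measurable_of_finite f
  have hprob : IsProbabilityMeasure (ν.map f) := Measure.isProbabilityMeasure_map hfm.aemeasurable
  have hae : ∀ᵐ x ∂(ν.map f), x ∈ X := by
    exact (ae_map_iff hfm.aemeasurable hX.measurableSet).2 (Filter.Eventually.of_forall hf)
  refine ⟨ν.map f, hprob, hae, ?_⟩
  refine Matrix.PosDef.of_dotProduct_mulVec_pos isHermitian_designMatrix fun u hu => ?_
  have h := inner_designMatrix hX hae (WithLp.toLp 2 u) (WithLp.toLp 2 u)
  rw [Matrix.inner_toEuclideanCLM] at h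
  simp only [star_trivial]
  rw [h]
  have hnn : 0 ≤ ∫ x, inner ℝ (WithLp.toLp 2 u) x * inner ℝ (WithLp.toLp 2 u) x ∂(ν.map f) :=
    integral_nonneg fun x => mul_self_nonneg _
  refine lt_of_le_of_ne hnn fun h0 => hu ?_
  have h1 := (integral_eq_zero_iff_of_nonneg (fun x => mul_self_nonneg _)
    (integrable_of_ae_mem_isCompact hX hae (Continuous.mul (by fun_prop) (by fun_prop)))).1 h0.symm
  have h2 := ae_of_ae_map hfm.aemeasurable h1
  have h3 : ∀ i, inner ℝ (WithLp.toLp 2 u) (f i) = 0 := by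
    intro i
    -- Every atom of the uniform measure has positive mass, so an almost everywhere identity holds
    -- at each `f i`.
    rw [ae_iff] at h2
    by_contra hi
    have h4 : ν {i} = 0 := measure_mono_null (by
      rintro _ rfl
      simpa using hi) h2
    rw [hν, uniformOn_univ] at h4
    simp at h4
  have h5 : WithLp.toLp 2 u ∈ (⊤ : Submodule ℝ (EuclideanSpace ℝ (Fin d)))ᗮ := by
    rw [← hspan, ← hfs, Submodule.mem_orthogonal]
    intro w hw
    refine Submodule.span_induction ?_ ?_ ?_ ?_ hw
    · rintro _ ⟨i, rfl⟩
      rw [real_inner_comm]; exact h3 i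
    · simp
    · intro a b _ _ ha hb
      rw [inner_add_left, ha, hb, add_zero]
    · intro a b _ hb
      rw [inner_smul_left, hb, mul_zero]
  rw [Submodule.top_orthogonal_eq_bot, Submodule.mem_bot] at h5
  simpa using h5

/-- Matrix determinant lemma, after factoring out the scalar `r`. -/
theorem det_smul_add_vecMulVec {n : Type*} [Fintype n] [DecidableEq n] {A : Matrix n n ℝ}
    (hA : IsUnit A.det) {r : ℝ} (hr : r ≠ 0) (s : ℝ) (x : n → ℝ) :
    (r • A + Matrix.vecMulVec (s • x) x).det =
      r ^ Fintype.card n * A.det * (1 + r⁻¹ * s * (x ⬝ᵥ A⁻¹.mulVec x)) := by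
  have h : r • A + Matrix.vecMulVec (s • x) x =
      r • (A + Matrix.vecMulVec ((r⁻¹ * s) • x) x) := by
    rw [smul_add, Matrix.smul_vecMulVec, Matrix.smul_vecMulVec, smul_smul, mul_inv_cancel_left₀ hr]
  have h2 : (1 + Matrix.replicateRow Unit x * A⁻¹ * Matrix.replicateCol Unit ((r⁻¹ * s) • x)).det =
      1 + r⁻¹ * s * (x ⬝ᵥ A⁻¹.mulVec x) := by
    rw [Matrix.det_unique, Matrix.mul_assoc]
    simp only [Matrix.add_apply, Matrix.one_apply_eq, Matrix.mul_apply, Matrix.replicateRow_apply,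
      Matrix.replicateCol_apply, Pi.smul_apply, smul_eq_mul, dotProduct, Matrix.mulVec,
      Finset.mul_sum]
    congr 1
    exact Finset.sum_congr rfl fun i _ => Finset.sum_congr rfl fun j _ => by ring
  rw [h, Matrix.det_smul, Matrix.vecMulVec_eq Unit, Matrix.det_add_replicateCol_mul_replicateRow hA,
    h2, ← mul_assoc]

/-- An approximately D-optimal design is approximately G-optimal. -/
theorem exists_design_forall_dotProduct_inv_le (hd : 1 ≤ d) (hX : IsCompact X)
    (hspan : Submodule.span ℝ X = ⊤) :
    ∃ μ ∈ nonsingularDesigns X, ∀ x ∈ X,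
      x.ofLp ⬝ᵥ (designMatrix μ)⁻¹.mulVec x.ofLp ≤ 8 * d := by
  obtain ⟨K, hK⟩ := exists_det_designMatrix_le hX
  set S : Set ℝ := (fun μ => (designMatrix μ).det) '' nonsingularDesigns X with hS
  have hSb : BddAbove S := ⟨K, by rintro _ ⟨μ, ⟨h1, h2, -⟩, rfl⟩; exact hK μ h1 h2⟩
  have hSn : S.Nonempty := (nonempty_nonsingularDesigns hd hX hspan).image _
  have hpos : 0 < sSup S := by
    obtain ⟨μ, hμ⟩ := nonempty_nonsingularDesigns hd hX hspan
    exact hμ.2.2.det_pos.trans_le (le_csSup hSb ⟨μ, hμ, rfl⟩)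
  obtain ⟨_, ⟨μ, hμ, rfl⟩, hlt⟩ := exists_lt_of_lt_csSup hSn (half_lt_self hpos)
  refine ⟨μ, hμ, fun x hx => ?_⟩
  obtain ⟨hp, hae, hpd⟩ := hμ
  have hd' : (1 : ℝ) ≤ d := by exact_mod_cast hd
  -- Mass of order `1 / d` on `x`: by Bernoulli the loss `(1 - s) ^ d` stays at least `1 / 2`, while
  -- the gain is at least `1 + s * q`.
  set s : ℝ := 1 / (2 * d) with hs
  have hs0 : 0 < s := by positivity
  have hsd : s * d = 1 / 2 := by rw [hs]; field_simp
  have hs1 : s ≤ 1 / 2 := by nlinarith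
  set q := x.ofLp ⬝ᵥ (designMatrix μ)⁻¹.mulVec x.ofLp with hq
  have hq0 : 0 ≤ q := by
    have := hpd.inv.posSemidef.dotProduct_mulVec_nonneg x.ofLp
    simpa using this
  have hmix := designMatrix_mix hX hae x hs0.le (by linarith)
  have hdet := det_smul_add_vecMulVec hpd.det_pos.ne'.isUnit (r := 1 - s) (by linarith) s x.ofLp
  rw [← hmix, ← hq, Fintype.card_fin] at hdet
  have hp' := isProbabilityMeasure_mix (μ := μ) x hs0.le (by linarith)
  have hae' := ae_mem_mix hae hX.measurableSet hx (1 - s).toNNReal s.toNNReal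
  have hr : 0 < 1 - s := by linarith
  have hb : 1 / 2 ≤ (1 - s) ^ d := by
    have := one_add_mul_le_pow (a := -s) (by linarith) d
    rw [← sub_eq_add_neg] at this
    linarith
  have hfac : 1 + s * q ≤ 1 + (1 - s)⁻¹ * s * q := by
    have h1 : 1 ≤ (1 - s)⁻¹ := (one_le_inv₀ hr).2 (by linarith)
    have : s * q ≤ (1 - s)⁻¹ * (s * q) := le_mul_of_one_le_left (by positivity) h1
    linarith
  have hD := hpd.det_pos
  have hsq : 0 ≤ s * q := by positivity
  have hlow : 1 / 2 * (designMatrix μ).det * (1 + s * q) ≤ (designMatrix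
      ((1 - s).toNNReal • μ + s.toNNReal • Measure.dirac x)).det := by
    rw [hdet]
    gcongr
  have hmem : (designMatrix ((1 - s).toNNReal • μ + s.toNNReal • Measure.dirac x)).det ∈ S := by
    refine ⟨_, ⟨hp', hae', (posDef_designMatrix_iff hX hae').2 (lt_of_lt_of_le ?_ hlow)⟩, rfl⟩
    positivity
  have hle := le_csSup hSb hmem
  -- Near-maximality: `(1 + s * q) / 2 * det ≤ sSup S < 2 * det`.
  have h4 : s * q ≤ 3 := by
    simp only at hlt
    by_contra! hcon
    nlinarith
  have : q = 2 * d * (s * q) := by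
    rw [hs]; field_simp
  rw [this]
  nlinarith

end Designs

/-! ### Gaussian moments and the two upper bounds -/

section UpperBounds

variable {d : ℕ} {X : Set (EuclideanSpace ℝ (Fin d))}

theorem inner_invSqrt (A : Matrix (Fin d) (Fin d) ℝ) (x y : EuclideanSpace ℝ (Fin d)) :
    inner ℝ x (invSqrt A y) = inner ℝ (invSqrt A x) y := by
  have h : IsSelfAdjoint (invSqrt A) :=
    ((Matrix.nonneg_iff_posSemidef.1 (CFC.sqrt_nonneg A)).inv.isHermitian.isSelfAdjoint).map _
  conv_rhs => rw [← h.adjoint_eq, ContinuousLinearMap.adjoint_inner_left]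

theorem norm_sq_invSqrt {A : Matrix (Fin d) (Fin d) ℝ} (hA : A.PosDef)
    (x : EuclideanSpace ℝ (Fin d)) :
    ‖invSqrt A x‖ ^ 2 = x.ofLp ⬝ᵥ A⁻¹.mulVec x.ofLp := by
  rw [← real_inner_self_eq_norm_sq, ← inner_invSqrt, invSqrt, ← mul_apply_eq_comp,
    ← map_mul, ← Matrix.mul_inv_rev, CFC.sqrt_mul_sqrt_self A hA.posSemidef.nonneg,
    Matrix.inner_toEuclideanCLM]

theorem supProcess_eq (A : Matrix (Fin d) (Fin d) ℝ) (g : EuclideanSpace ℝ (Fin d)) :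
    supProcess X A g = ⨆ x : X, inner ℝ (invSqrt A x) g := by
  simp only [supProcess, inner_invSqrt]

theorem inner_le_supProcess (hX : IsCompact X) (A : Matrix (Fin d) (Fin d) ℝ)
    (g : EuclideanSpace ℝ (Fin d)) {x : EuclideanSpace ℝ (Fin d)} (hx : x ∈ X) :
    inner ℝ (invSqrt A x) g ≤ supProcess X A g := by
  rw [← inner_invSqrt]
  exact le_ciSup (bddAbove_supProcess hX A g) (⟨x, hx⟩ : X)

theorem map_inner_stdGaussian (v : EuclideanSpace ℝ (Fin d)) :
    (stdGaussian (EuclideanSpace ℝ (Fin d))).map (fun g => inner ℝ v g) =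
      gaussianReal 0 (‖v‖ ^ 2).toNNReal := by
  have h := IsGaussian.map_eq_gaussianReal (μ := stdGaussian (EuclideanSpace ℝ (Fin d)))
    (innerSL ℝ v)
  rw [integral_strongDual_stdGaussian, variance_dual_stdGaussian, innerSL_apply_norm] at h
  exact h

theorem integral_inner_sq_stdGaussian (v : EuclideanSpace ℝ (Fin d)) :
    ∫ g, (inner ℝ v g) ^ 2 ∂stdGaussian (EuclideanSpace ℝ (Fin d)) = ‖v‖ ^ 2 := by
  have h := variance_dual_stdGaussian (E := EuclideanSpace ℝ (Fin d)) (innerSL ℝ v)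
  rw [variance_of_integral_eq_zero (by fun_prop) (integral_strongDual_stdGaussian _),
    innerSL_apply_norm] at h
  exact h

theorem integrable_norm_sq_stdGaussian :
    Integrable (fun g => ‖g‖ ^ 2) (stdGaussian (EuclideanSpace ℝ (Fin d))) := by
  have h := IsGaussian.memLp_two_id (μ := stdGaussian (EuclideanSpace ℝ (Fin d)))
  simpa using h.integrable_norm_pow (by norm_num)

theorem integral_norm_sq_stdGaussian :
    ∫ g, ‖g‖ ^ 2 ∂stdGaussian (EuclideanSpace ℝ (Fin d)) = d := by
  have h : ∀ g : EuclideanSpace ℝ (Fin d),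
      ‖g‖ ^ 2 = ∑ i, inner ℝ (EuclideanSpace.basisFun (Fin d) ℝ i) g ^ 2 := fun g => by
    rw [← (EuclideanSpace.basisFun (Fin d) ℝ).sum_sq_norm_inner_right g]
    simp
  simp_rw [h]
  rw [integral_finsetSum]
  · simp [integral_inner_sq_stdGaussian]
  · intro i _
    refine integrable_norm_sq_stdGaussian.mono' (by fun_prop) (Filter.Eventually.of_forall fun g => ?_)
    rw [h, Real.norm_of_nonneg (sq_nonneg _)]
    exact Finset.single_le_sum (f := fun i => inner ℝ (EuclideanSpace.basisFun (Fin d) ℝ i) g ^ 2)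
      (fun i _ => sq_nonneg _) (Finset.mem_univ i)

/-- If all `A^{-1/2} x` have norm at most `σ`, the width is at most `σ √d`. -/
theorem gaussianWidthAt_le_mul_sqrt (hd : 1 ≤ d) (hX : IsCompact X) (hne : X.Nonempty)
    {A : Matrix (Fin d) (Fin d) ℝ} {σ : ℝ} (hσ : ∀ x ∈ X, ‖invSqrt A x‖ ≤ σ) :
    gaussianWidthAt X A ≤ σ * √d := by
  have : Nonempty X := hne.to_subtype
  have hσ0 : 0 ≤ σ := (norm_nonneg _).trans (hσ _ hne.some_mem)
  have hd' : (0 : ℝ) < d := by exact_mod_cast hd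
  have hpos : 0 < √(d : ℝ) := Real.sqrt_pos.2 hd'
  -- AM-GM linearizes `‖g‖` in `‖g‖ ^ 2`, replacing Jensen's inequality; it is tight at `‖g‖ = √d`.
  have hpt : ∀ g, supProcess X A g ≤ σ * (2 * √d)⁻¹ * ‖g‖ ^ 2 + σ * √d / 2 := by
    intro g
    have h1 : supProcess X A g ≤ σ * ‖g‖ := by
      rw [supProcess_eq]
      refine ciSup_le fun x => (real_inner_le_norm _ _).trans ?_
      gcongr
      exact hσ x x.2
    have h2 : ‖g‖ ≤ (2 * √d)⁻¹ * ‖g‖ ^ 2 + √d / 2 := by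
      have : (2 * √d)⁻¹ * ‖g‖ ^ 2 + √d / 2 - ‖g‖ = (2 * √d)⁻¹ * (‖g‖ - √d) ^ 2 := by
        field_simp
        ring
      have h3 : 0 ≤ (2 * √d)⁻¹ * (‖g‖ - √d) ^ 2 := by positivity
      linarith
    calc _ ≤ σ * ‖g‖ := h1
      _ ≤ σ * ((2 * √d)⁻¹ * ‖g‖ ^ 2 + √d / 2) := by gcongr
      _ = _ := by ring
  have hi : Integrable (fun g => σ * (2 * √d)⁻¹ * ‖g‖ ^ 2)
    (stdGaussian (EuclideanSpace ℝ (Fin d))) := integrable_norm_sq_stdGaussian.const_mul _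
  calc gaussianWidthAt X A
      ≤ ∫ g, (σ * (2 * √d)⁻¹ * ‖g‖ ^ 2 + σ * √d / 2)
          ∂stdGaussian (EuclideanSpace ℝ (Fin d)) :=
        integral_mono (integrable_supProcess hX hne A) (hi.add (integrable_const _)) hpt
    _ = σ * √d := by
        rw [integral_add hi (integrable_const _), integral_const_mul, integral_norm_sq_stdGaussian]
        simp only [integral_const, probReal_univ, smul_eq_mul, one_mul]
        have := Real.sq_sqrt hd'.le
        field_simp
        rw [this]
        ring

theorem integrable_exp_inner_stdGaussian (β : ℝ) (v : EuclideanSpace ℝ (Fin d)) :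
    Integrable (fun g => Real.exp (β * inner ℝ v g))
      (stdGaussian (EuclideanSpace ℝ (Fin d))) := by
  have h := integrable_exp_mul_gaussianReal (μ := 0) (v := (‖v‖ ^ 2).toNNReal) β
  rw [← map_inner_stdGaussian] at h
  exact h.comp_measurable (by fun_prop)

theorem integral_exp_inner_stdGaussian (β : ℝ) (v : EuclideanSpace ℝ (Fin d)) :
    ∫ g, Real.exp (β * inner ℝ v g) ∂stdGaussian (EuclideanSpace ℝ (Fin d)) =
      Real.exp (‖v‖ ^ 2 * β ^ 2 / 2) := by
  have h := mgf_gaussianReal (map_inner_stdGaussian v) β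
  rw [zero_mul, zero_add, Real.coe_toNNReal _ (sq_nonneg _)] at h
  exact h

/-- The exponential-moment bound for the expected maximum of finitely many Gaussians. -/
theorem gaussianWidthAt_le_of_finite (hX : X.Finite) (hne : X.Nonempty)
    {A : Matrix (Fin d) (Fin d) ℝ} {V : ℝ} (hV : ∀ x ∈ X, ‖invSqrt A x‖ ^ 2 ≤ V)
    {β : ℝ} (hβ : 0 < β) :
    gaussianWidthAt X A ≤ Real.log X.ncard / β + β * V / 2 := by
  have : Nonempty X := hne.to_subtype
  have hn : (0 : ℝ) < X.ncard := by exact_mod_cast (Set.ncard_pos hX).2 hne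
  -- `K` bounds the expectation of the exponential sum `F`. The tangent line of the logarithm at `K`
  -- again does the work of Jensen.
  set K : ℝ := X.ncard * Real.exp (V * β ^ 2 / 2) with hK
  have hK0 : 0 < K := by positivity
  have hlogK : Real.log K = Real.log X.ncard + V * β ^ 2 / 2 := by
    rw [hK, Real.log_mul hn.ne' (Real.exp_pos _).ne', Real.log_exp]
  set F : EuclideanSpace ℝ (Fin d) → ℝ :=
    fun g => ∑ x ∈ hX.toFinset, Real.exp (β * inner ℝ (invSqrt A x) g) with hF
  have hFi : Integrable F (stdGaussian (EuclideanSpace ℝ (Fin d))) :=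
    integrable_finsetSum _ fun x _ => integrable_exp_inner_stdGaussian β _
  have hFint : ∫ g, F g ∂stdGaussian (EuclideanSpace ℝ (Fin d)) ≤ K := by
    rw [hF, integral_finsetSum _ fun x _ => integrable_exp_inner_stdGaussian β _]
    simp_rw [integral_exp_inner_stdGaussian]
    rw [hK, Set.ncard_eq_toFinset_card X hX, ← nsmul_eq_mul]
    refine Finset.sum_le_card_nsmul _ _ _ fun x hx => ?_
    have := hV x (hX.mem_toFinset.1 hx)
    gcongr
  have hpt : ∀ g, supProcess X A g ≤ (β * K)⁻¹ * F g + (Real.log K - 1) / β := by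
    intro g
    rw [supProcess_eq]
    refine ciSup_le fun x => ?_
    set z := inner ℝ (invSqrt A x) g with hz
    have h1 : Real.exp (β * z) ≤ F g := Finset.single_le_sum
      (f := fun x => Real.exp (β * inner ℝ (invSqrt A x) g))
      (fun i _ => (Real.exp_pos _).le) (hX.mem_toFinset.2 x.2)
    have h2 := Real.add_one_le_exp (β * z - Real.log K)
    rw [Real.exp_sub, Real.exp_log hK0] at h2
    have h3 : Real.exp (β * z) / K ≤ F g / K := by gcongr
    have h4 : z ≤ (F g / K + (Real.log K - 1)) / β := by
      rw [le_div_iff₀ hβ]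
      linarith
    calc z ≤ _ := h4
      _ = _ := by field_simp
  have hi : Integrable (fun g => (β * K)⁻¹ * F g) (stdGaussian (EuclideanSpace ℝ (Fin d))) :=
    hFi.const_mul _
  calc gaussianWidthAt X A
      ≤ ∫ g, ((β * K)⁻¹ * F g + (Real.log K - 1) / β)
          ∂stdGaussian (EuclideanSpace ℝ (Fin d)) :=
        integral_mono (integrable_supProcess hX.isCompact hne A)
          (hi.add (integrable_const _)) hpt
    _ = (β * K)⁻¹ * ∫ g, F g ∂stdGaussian (EuclideanSpace ℝ (Fin d)) + (Real.log K - 1) / β := by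
        rw [integral_add hi (integrable_const _), integral_const_mul]
        simp
    _ ≤ (β * K)⁻¹ * K + (Real.log K - 1) / β := by gcongr
    _ = _ := by
        rw [hlogK]
        field_simp
        ring

theorem nonempty_of_span_eq_top (hd : 1 ≤ d) (hspan : Submodule.span ℝ X = ⊤) : X.Nonempty := by
  rw [Set.nonempty_iff_ne_empty]
  rintro rfl
  have : Nontrivial (EuclideanSpace ℝ (Fin d)) :=
    Module.nontrivial_of_finrank_pos (R := ℝ) (by simpa using Nat.pos_of_ne_zero (by omega))
  rw [Submodule.span_empty] at hspan
  exact bot_ne_top hspan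

theorem gaussianWidth_le_mul (hd : 1 ≤ d) (hX : IsCompact X) (hspan : Submodule.span ℝ X = ⊤) :
    gaussianWidth X ≤ ((√8 * (d : ℝ) : ℝ) : EReal) := by
  obtain ⟨μ, hμ, hq⟩ := exists_design_forall_dotProduct_inv_le hd hX hspan
  refine iInf₂_le_of_le μ hμ (EReal.coe_le_coe_iff.2 ?_)
  have h := gaussianWidthAt_le_mul_sqrt (A := designMatrix μ) (σ := √(8 * d)) hd hX
    (nonempty_of_span_eq_top hd hspan) fun x hx =>
      Real.le_sqrt_of_sq_le ((norm_sq_invSqrt hμ.2.2 x).trans_le (hq x hx))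
  rwa [Real.sqrt_mul (by norm_num), mul_assoc, Real.mul_self_sqrt (Nat.cast_nonneg d)] at h

theorem gaussianWidth_le_sqrt_log (hd : 1 ≤ d) (hX : X.Finite)
    (hspan : Submodule.span ℝ X = ⊤) :
    gaussianWidth X ≤ ((5 * √((d : ℝ) * Real.log (X.ncard : ℝ)) : ℝ) : EReal) := by
  have hne := nonempty_of_span_eq_top hd hspan
  have hd' : (0 : ℝ) < d := by exact_mod_cast hd
  obtain ⟨μ, hμ, hq⟩ := exists_design_forall_dotProduct_inv_le hd hX.isCompact hspan
  refine iInf₂_le_of_le μ hμ (EReal.coe_le_coe_iff.2 ?_)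
  have h : ∀ β : ℝ, 0 < β → _ := fun β hβ =>
    gaussianWidthAt_le_of_finite (A := designMatrix μ) (V := 8 * d) hX hne
      (fun x hx => (norm_sq_invSqrt hμ.2.2 x).trans_le (hq x hx)) hβ
  set L := Real.log (X.ncard : ℝ) with hL
  have hL0 : 0 ≤ L := Real.log_natCast_nonneg _
  rcases hL0.eq_or_lt with h0 | h0
  · rw [← h0, mul_zero, Real.sqrt_zero, mul_zero]
    -- For `log |X| = 0` the optimal `β` degenerates to `0`, so let it tend there.
    refine le_of_forall_pos_le_add fun ε hε => ?_
    have := h (ε / (4 * d)) (by positivity)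
    rw [← h0] at this
    calc _ ≤ _ := this
      _ = _ := by field_simp; ring
  · have hs : 0 < √(d * L) := by positivity
    have hss : √(d * L) * √(d * L) = d * L := Real.mul_self_sqrt (by positivity)
    -- This `β` balances the terms up to constants: they become `√(d * L)` and `4 * √(d * L)`.
    have h1 := h (√(d * L) / d) (by positivity)
    have h2 : L / (√(d * L) / d) = √(d * L) := by
      rw [div_div_eq_mul_div, div_eq_iff hs.ne', hss, mul_comm]
    rw [h2] at h1
    calc _ ≤ _ := h1
      _ = _ := by field_simp; ring

end UpperBounds

/-! ### Isotropy and greedy selection -/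

section LowerBound

variable {d : ℕ} {X : Set (EuclideanSpace ℝ (Fin d))}

/-- The image of the design under `A^{-1/2}` is isotropic. -/
theorem integral_inner_invSqrt_sq {μ : Measure (EuclideanSpace ℝ (Fin d))} [IsFiniteMeasure μ]
    (hX : IsCompact X) (hμ : ∀ᵐ x ∂μ, x ∈ X) (hA : (designMatrix μ).PosDef)
    (v : EuclideanSpace ℝ (Fin d)) :
    ∫ x, inner ℝ v (invSqrt (designMatrix μ) x) ^ 2 ∂μ = ‖v‖ ^ 2 := by
  simp_rw [inner_invSqrt, sq (inner ℝ _ _)]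
  rw [← inner_designMatrix hX hμ, ← inner_invSqrt]
  have hS := CFC.sqrt_mul_sqrt_self _ hA.posSemidef.nonneg
  have hu : IsUnit (CFC.sqrt (designMatrix μ)).det := by
    refine isUnit_of_mul_isUnit_left (y := (CFC.sqrt (designMatrix μ)).det) ?_
    rw [← Matrix.det_mul, hS]
    exact hA.det_pos.ne'.isUnit
  have h : (CFC.sqrt (designMatrix μ))⁻¹ * designMatrix μ * (CFC.sqrt (designMatrix μ))⁻¹ = 1 := by
    nth_rewrite 2 [← hS]
    rw [mul_assoc, mul_assoc, Matrix.mul_nonsing_inv _ hu, mul_one, Matrix.nonsing_inv_mul _ hu]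
  rw [invSqrt, ← mul_apply_eq_comp, ← mul_apply_eq_comp, ← map_mul, ← map_mul, h, map_one]
  simp

/-- By isotropy, summed over an orthonormal basis of `V`, the mean of the squared projection is `dim
V`; some point of `X` reaches the mean. -/
theorem exists_finrank_le_norm_sq_starProjection {μ : Measure (EuclideanSpace ℝ (Fin d))}
    [IsProbabilityMeasure μ] (hX : IsCompact X) (hμ : ∀ᵐ x ∂μ, x ∈ X)
    (hA : (designMatrix μ).PosDef) (V : Submodule ℝ (EuclideanSpace ℝ (Fin d))) :
    ∃ x ∈ X, (Module.finrank ℝ V : ℝ) ≤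
      ‖V.starProjection (invSqrt (designMatrix μ) x)‖ ^ 2 := by
  set b := stdOrthonormalBasis ℝ V
  have h : ∀ y : EuclideanSpace ℝ (Fin d),
      ‖V.starProjection y‖ ^ 2 = ∑ i, inner ℝ (b i : EuclideanSpace ℝ (Fin d)) y ^ 2 := fun y => by
    rw [Submodule.starProjection_apply, ← Submodule.coe_norm, ← b.sum_sq_norm_inner_right]
    refine Finset.sum_congr rfl fun i _ => ?_
    rw [Real.norm_eq_abs, sq_abs, Submodule.inner_orthogonalProjectionOnto_eq_of_mem_left]
  have hint : ∀ {f : EuclideanSpace ℝ (Fin d) → ℝ}, Continuous f → Integrable f μ :=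
    fun hf => integrable_of_ae_mem_isCompact hX hμ hf
  obtain ⟨x, hx, hle⟩ := exists_notMem_null_integral_le (μ := μ)
    (f := fun x => ‖V.starProjection (invSqrt (designMatrix μ) x)‖ ^ 2)
    (hint (by fun_prop)) (N := Xᶜ) hμ
  refine ⟨x, by simpa using hx, ?_⟩
  refine le_trans (le_of_eq ?_) hle
  simp_rw [h]
  rw [integral_finsetSum _ fun i _ => hint (by fun_prop)]
  simp_rw [integral_inner_invSqrt_sq hX hμ hA, ← Submodule.coe_norm, b.norm_eq_one]
  simp

/-- Greedy choice of points with large components along orthonormal directions that are all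
orthogonal to a given vector. -/
theorem exists_orthonormal_large_inner {Y : Set (EuclideanSpace ℝ (Fin d))}
    (hY : ∀ V : Submodule ℝ (EuclideanSpace ℝ (Fin d)),
      ∃ y ∈ Y, (Module.finrank ℝ V : ℝ) ≤ ‖V.starProjection y‖ ^ 2)
    (y₀ : EuclideanSpace ℝ (Fin d)) {n : ℕ} (hn : n + 1 ≤ d) :
    ∃ e y : ℕ → EuclideanSpace ℝ (Fin d),
      (∀ i < n, ∀ j < n, inner ℝ (e i) (e j) = if i = j then (1 : ℝ) else 0) ∧
      (∀ i < n, inner ℝ y₀ (e i) = 0) ∧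
      ∀ i < n, y i ∈ Y ∧ √((d : ℝ) - 1 - i) ≤ inner ℝ (y i) (e i) := by
  induction n with
  | zero => exact ⟨fun _ => 0, fun _ => 0, by simp, by simp, by simp⟩
  | succ k ih =>
    obtain ⟨e, y, he, h0, hy⟩ := ih (by omega)
    -- The next direction must avoid `y₀` and the `k` previous ones, hence the dimension `d - 1 -
    -- k`; it is the normalized projection of the new point.
    set w : Fin (k + 1) → EuclideanSpace ℝ (Fin d) := Fin.cons y₀ fun i => e i
    set W := Submodule.span ℝ (Set.range w)
    have hW : Module.finrank ℝ W ≤ k + 1 :=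
      (finrank_range_le_card (R := ℝ) w).trans (by simp)
    have hdim := W.finrank_add_finrank_orthogonal
    rw [finrank_euclideanSpace_fin] at hdim
    obtain ⟨z, hz, hzn⟩ := hY Wᗮ
    set p := Wᗮ.starProjection z with hp
    have hfr : (d : ℝ) - 1 - k ≤ Module.finrank ℝ Wᗮ := by
      have : d ≤ Module.finrank ℝ Wᗮ + 1 + k := by omega
      have : (d : ℝ) ≤ Module.finrank ℝ Wᗮ + 1 + k := by exact_mod_cast this
      linarith
    have hkd : (k : ℝ) + 2 ≤ d := by exact_mod_cast hn
    have hp0 : 0 < ‖p‖ := by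
      refine (norm_nonneg p).lt_of_ne fun h => ?_
      rw [← h] at hzn
      linarith
    have hpW : p ∈ Wᗮ := Submodule.starProjection_apply_mem _ _
    have hzp : inner ℝ z p = ‖p‖ ^ 2 := by
      rw [← real_inner_self_eq_norm_sq]
      conv_rhs => rw [hp, Submodule.inner_starProjection_left_eq_right, ← hp,
        Submodule.starProjection_eq_self_iff.2 hpW]
    have hwp : ∀ i, inner ℝ (w i) p = 0 := fun i =>
      (Submodule.mem_orthogonal _ _).1 hpW _ (Submodule.subset_span ⟨i, rfl⟩)
    have hep : ∀ i < k, inner ℝ (e i) p = 0 := fun i hi => hwp (Fin.succ ⟨i, hi⟩)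
    refine ⟨Function.update e k (‖p‖⁻¹ • p), Function.update y k z, ?_, ?_, ?_⟩
    · intro i hi j hj
      rcases Nat.lt_succ_iff_lt_or_eq.1 hi with hi | rfl <;>
        rcases Nat.lt_succ_iff_lt_or_eq.1 hj with hj | rfl
      · rw [Function.update_of_ne hi.ne, Function.update_of_ne hj.ne, he i hi j hj]
      · rw [Function.update_of_ne hi.ne, Function.update_self, inner_smul_right, hep i hi,
          if_neg hi.ne, mul_zero]
      · rw [Function.update_of_ne hj.ne, Function.update_self, real_inner_comm, inner_smul_right,
          hep j hj, if_neg hj.ne', mul_zero]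
      · rw [Function.update_self, inner_smul_right, inner_smul_left, real_inner_self_eq_norm_sq,
          if_pos rfl]
        simp only [map_inv₀, conj_trivial]
        field_simp
    · intro i hi
      rcases Nat.lt_succ_iff_lt_or_eq.1 hi with hi | rfl
      · rw [Function.update_of_ne hi.ne, h0 i hi]
      · rw [Function.update_self, inner_smul_right]
        have : inner ℝ y₀ p = 0 := hwp 0
        rw [this, mul_zero]
    · intro i hi
      rcases Nat.lt_succ_iff_lt_or_eq.1 hi with hi | rfl
      · rw [Function.update_of_ne hi.ne, Function.update_of_ne hi.ne]
        exact hy i hi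
      · rw [Function.update_self, Function.update_self, inner_smul_right, hzp]
        refine ⟨hz, ?_⟩
        rw [sq, inv_mul_cancel_left₀ hp0.ne', Real.sqrt_le_left hp0.le]
        exact hfr.trans hzn

/-! ### The first-exceedance selection rule -/

theorem integral_eq_zero_of_odd {f : ℝ → ℝ} (hf : ∀ z, f (-z) = -f z) :
    ∫ z, f z ∂gaussianReal 0 1 = 0 := by
  have h : _ = ∫ z, f (-z) ∂gaussianReal 0 1 :=
    integral_map_equiv (μ := gaussianReal 0 1) (MeasurableEquiv.neg ℝ) f
  have h2 : (gaussianReal 0 1).map (MeasurableEquiv.neg ℝ) = gaussianReal 0 1 := by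
    have := gaussianReal_map_neg (μ := 0) (v := 1)
    rwa [neg_zero] at this
  rw [h2] at h
  simp only [hf, integral_neg] at h
  linarith

/-- The event that `i` is the first coordinate of absolute value at least `t`, and `x i ≥ t`,
factored over the coordinates. -/
def firstExceed (t : ℝ) (i j : Fin d) (z : ℝ) : Prop :=
  (j < i → |z| < t) ∧ (j = i → t ≤ z)

open Classical in
/-- The indicator of `firstExceed`. -/
noncomputable def firstExceedInd (t : ℝ) (i j : Fin d) (z : ℝ) : ℝ :=
  if firstExceed t i j z then 1 else 0

open Classical in
theorem prod_firstExceedInd (t : ℝ) (i : Fin d) (x : Fin d → ℝ) :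
    ∏ j, firstExceedInd t i j (x j) = if ∀ j, firstExceed t i j (x j) then 1 else 0 := by
  simp only [firstExceedInd, Finset.prod_ite_zero, Finset.mem_univ, true_implies,
    Finset.prod_const_one]

theorem firstExceed_unique {t : ℝ} {i i' : Fin d} {x : Fin d → ℝ}
    (h : ∀ j, firstExceed t i j (x j)) (h' : ∀ j, firstExceed t i' j (x j)) : i = i' := by
  rcases lt_trichotomy i i' with hlt | rfl | hlt
  · exact absurd ((h' i).1 hlt) (not_lt.2 (((h i).2 rfl).trans (le_abs_self _)))
  · rfl
  · exact absurd ((h i').1 hlt) (not_lt.2 (((h' i').2 rfl).trans (le_abs_self _)))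

theorem measurable_firstExceedInd (t : ℝ) (i j : Fin d) : Measurable (firstExceedInd t i j) := by
  unfold firstExceedInd
  refine Measurable.ite ?_ measurable_const measurable_const
  have h1 : MeasurableSet {z : ℝ | |z| < t} := measurableSet_lt (by fun_prop) (by fun_prop)
  have h2 : MeasurableSet {z : ℝ | t ≤ z} := measurableSet_Ici
  simp only [firstExceed]
  exact (MeasurableSet.imp (.const _) h1).inter (MeasurableSet.imp (.const _) h2)

theorem norm_firstExceedInd_le (t : ℝ) (i j : Fin d) (z : ℝ) : ‖firstExceedInd t i j z‖ ≤ 1 := by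
  unfold firstExceedInd
  split_ifs <;> simp

theorem firstExceedInd_neg {t : ℝ} {i j : Fin d} (hij : j ≠ i) (z : ℝ) :
    firstExceedInd t i j (-z) = firstExceedInd t i j z := by
  simp [firstExceedInd, firstExceed, hij]

/-- Product form over the coordinates, so that integrals against the product measure factor. -/
theorem firstExceed_mul_coord (t : ℝ) (i j : Fin d) (x : Fin d → ℝ) :
    (∏ k, firstExceedInd t i k (x k)) * x j =
      ∏ k, (firstExceedInd t i k (x k) * if k = j then x k else 1) := by
  rw [Finset.prod_mul_distrib]
  simp

theorem integrable_firstExceed_mul_coord (t : ℝ) (i j : Fin d) :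
    Integrable (fun x : Fin d → ℝ => (∏ k, firstExceedInd t i k (x k)) * x j)
      (Measure.pi fun _ => gaussianReal 0 1) := by
  simp_rw [firstExceed_mul_coord]
  refine Integrable.fintype_prod
    (f := fun k z => firstExceedInd t i k z * if k = j then z else 1) fun k => ?_
  refine Integrable.bdd_mul (c := 1) ?_ (measurable_firstExceedInd t i k).aestronglyMeasurable
    (Filter.Eventually.of_forall (norm_firstExceedInd_le t i k))
  split_ifs
  · exact IsGaussian.integrable_id
  · exact integrable_const _

/-- The factor at `j ≠ i` is a symmetric indicator (`j < i`) or `1` (`j > i`), times `z`: an odd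
function. -/
theorem integral_firstExceed_mul_coord_of_ne (t : ℝ) {i j : Fin d} (hij : j ≠ i) :
    ∫ x : Fin d → ℝ, (∏ k, firstExceedInd t i k (x k)) * x j
      ∂(Measure.pi fun _ => gaussianReal 0 1) = 0 := by
  simp_rw [firstExceed_mul_coord]
  rw [integral_fintype_prod_eq_prod
    (fun k z => firstExceedInd t i k z * if k = j then z else 1)]
  refine Finset.prod_eq_zero (Finset.mem_univ j) (integral_eq_zero_of_odd fun z => ?_)
  simp [firstExceedInd_neg hij]

open Classical in
theorem integral_firstExceed_mul_coord_self (t : ℝ) (i : Fin d) :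
    ∫ x : Fin d → ℝ, (∏ k, firstExceedInd t i k (x k)) * x i
      ∂(Measure.pi fun _ => gaussianReal 0 1) =
      (∫ z, (if t ≤ z then z else 0) ∂gaussianReal 0 1) *
        (∫ z, (if |z| < t then (1 : ℝ) else 0) ∂gaussianReal 0 1) ^ (i : ℕ) := by
  simp_rw [firstExceed_mul_coord]
  rw [integral_fintype_prod_eq_prod
    (fun k z => firstExceedInd t i k z * if k = i then z else 1)]
  have h : ∀ k : Fin d, (∫ z, firstExceedInd t i k z * (if k = i then z else 1) ∂gaussianReal 0 1) =
      (if k = i then ∫ z, (if t ≤ z then z else 0) ∂gaussianReal 0 1 else 1) *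
        (if k < i then ∫ z, (if |z| < t then (1 : ℝ) else 0) ∂gaussianReal 0 1 else 1) := by
    intro k
    rcases lt_trichotomy k i with hlt | rfl | hlt
    · simp [firstExceedInd, firstExceed, hlt, hlt.ne]
    · simp [firstExceedInd, firstExceed]
    · simp [firstExceedInd, firstExceed, hlt.ne', hlt.not_gt]
  simp_rw [h]
  rw [Finset.prod_mul_distrib, Finset.prod_ite_eq' Finset.univ i, if_pos (Finset.mem_univ i),
    ← Finset.prod_filter, Finset.prod_const]
  congr 2
  rw [← Fin.card_Iio i]
  congr 1
  ext
  simp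

/-- A lower bound for the expectation of a function dominating a Gaussian process: the process is
evaluated at the point selected by the first coordinate exceeding `t` in absolute value. -/
theorem le_integral_of_inner_le (b : OrthonormalBasis (Fin d) ℝ (EuclideanSpace ℝ (Fin d)))
    {F : EuclideanSpace ℝ (Fin d) → ℝ} (hF : Integrable F (stdGaussian _))
    {y₀ : EuclideanSpace ℝ (Fin d)} {y : Fin d → EuclideanSpace ℝ (Fin d)} {S : Finset (Fin d)}
    (hF0 : ∀ g, inner ℝ y₀ g ≤ F g) (hFy : ∀ i ∈ S, ∀ g, inner ℝ (y i) g ≤ F g) (t : ℝ) :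
    ∑ i ∈ S, inner ℝ (y i - y₀) (b i) *
      ∫ x : Fin d → ℝ, (∏ k, firstExceedInd t i k (x k)) * x i
        ∂(Measure.pi fun _ => gaussianReal 0 1) ≤ ∫ g, F g ∂stdGaussian _ := by
  classical
  set P := Measure.pi fun _ : Fin d => gaussianReal 0 1 with hP
  set w : Fin d → (Fin d → ℝ) → ℝ := fun i x => ∏ k, firstExceedInd t i k (x k) with hw
  set G : (Fin d → ℝ) → EuclideanSpace ℝ (Fin d) := fun x => ∑ i, x i • b i with hG
  have hGm : Measurable G := by fun_prop
  have hstd := stdGaussian_eq_map_pi_orthonormalBasis b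
  rw [hstd] at hF
  rw [hstd, integral_map hGm.aemeasurable hF.aestronglyMeasurable]
  have hinner : ∀ v x, inner ℝ v (G x) = ∑ j, inner ℝ v (b j) * x j := fun v x => by
    simp only [hG, inner_sum, inner_smul_right, mul_comm]
  -- At most one weight `w i x` is nonzero, so the left side is the process at the selected `y i`,
  -- or at `y₀` if none is selected.
  have hpt : ∀ x, inner ℝ y₀ (G x) + ∑ i ∈ S, ∑ j, inner ℝ (y i - y₀) (b j) * (w i x * x j) ≤
      F (G x) := by
    intro x
    have hsum : ∀ i, ∑ j, inner ℝ (y i - y₀) (b j) * (w i x * x j) =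
        w i x * inner ℝ (y i - y₀) (G x) := fun i => by
      rw [hinner, Finset.mul_sum]
      exact Finset.sum_congr rfl fun j _ => by ring
    simp_rw [hsum, hw, prod_firstExceedInd]
    by_cases hex : ∃ i ∈ S, ∀ j, firstExceed t i j (x j)
    · obtain ⟨i, hi, hij⟩ := hex
      rw [Finset.sum_eq_single_of_mem i hi fun i' _ hne => by
        rw [if_neg fun h => hne (firstExceed_unique h hij), zero_mul], if_pos hij, one_mul,
        inner_sub_left]
      linarith [hFy i hi (G x)]
    · push Not at hex
      rw [Finset.sum_eq_zero fun i hi => by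
        rw [if_neg (by simpa using hex i hi), zero_mul], add_zero]
      exact hF0 _
  have hint : ∀ i j, Integrable (fun x => inner ℝ (y i - y₀) (b j) * (w i x * x j)) P :=
    fun i j => (integrable_firstExceed_mul_coord t i j).const_mul _
  have hi0 : Integrable (fun x => inner ℝ y₀ (G x)) P := by
    have h : Integrable (fun g => inner ℝ y₀ g) (stdGaussian (EuclideanSpace ℝ (Fin d))) :=
      IsGaussian.integrable_id.const_inner y₀
    rw [hstd] at h
    exact h.comp_measurable hGm
  have h0 : ∫ x, inner ℝ y₀ (G x) ∂P = 0 := by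
    have h := integral_strongDual_stdGaussian (innerSL ℝ y₀)
    rw [hstd, integral_map hGm.aemeasurable (by fun_prop)] at h
    exact h
  have hi1 : Integrable (fun x => ∑ i ∈ S, ∑ j, inner ℝ (y i - y₀) (b j) * (w i x * x j)) P :=
    integrable_finsetSum _ fun i _ => integrable_finsetSum _ fun j _ => hint i j
  refine le_trans (le_of_eq ?_) (integral_mono (hi0.add hi1) (hF.comp_measurable hGm) hpt)
  simp only [Pi.add_apply]
  rw [integral_add hi0 hi1, h0, zero_add, integral_finsetSum _ fun i _ =>
    integrable_finsetSum _ fun j _ => hint i j]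
  refine Finset.sum_congr rfl fun i _ => ?_
  rw [integral_finsetSum _ fun j _ => hint i j, Finset.sum_eq_single i]
  · rw [integral_const_mul]
  · intro j _ hji
    rw [integral_const_mul, integral_firstExceed_mul_coord_of_ne t hji, mul_zero]
  · simp

/-! ### One-dimensional Gaussian tail estimates -/

open Classical in
theorem integrable_ite_le_gaussian (t : ℝ) :
    Integrable (fun z => if t ≤ z then z else 0) (gaussianReal 0 1) :=
  (IsGaussian.integrable_id (μ := gaussianReal 0 1)).indicator measurableSet_Ici

open Classical in
theorem integrable_ite_abs_lt_gaussian (t : ℝ) :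
    Integrable (fun z => if |z| < t then (1 : ℝ) else 0) (gaussianReal 0 1) :=
  (integrable_const (1 : ℝ)).indicator (s := {z : ℝ | |z| < t})
    (measurableSet_lt (by fun_prop) (by fun_prop))

-- On `|z| ≥ t` one has `t ≤ |z|`, and by symmetry the two tails contribute equally.
open Classical in
theorem mul_one_sub_le_two_mul_integral_tail {t : ℝ} (ht : 0 ≤ t) :
    t * (1 - ∫ z, (if |z| < t then (1 : ℝ) else 0) ∂gaussianReal 0 1) ≤
      2 * ∫ z, (if t ≤ z then z else 0) ∂gaussianReal 0 1 := by
  have hm := integrable_ite_le_gaussian t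
  have hq := integrable_ite_abs_lt_gaussian t
  have h2 : (gaussianReal 0 1).map (MeasurableEquiv.neg ℝ) = gaussianReal 0 1 := by
    have := gaussianReal_map_neg (μ := 0) (v := 1)
    rwa [neg_zero] at this
  have hm' : Integrable (fun z => if t ≤ -z then -z else 0) (gaussianReal 0 1) := by
    rw [← h2] at hm
    exact hm.comp_measurable (MeasurableEquiv.neg ℝ).measurable
  have hsymm : ∫ z, (if t ≤ -z then -z else 0) ∂gaussianReal 0 1 =
      ∫ z, (if t ≤ z then z else 0) ∂gaussianReal 0 1 := by
    have h := integral_map_equiv (μ := gaussianReal 0 1) (MeasurableEquiv.neg ℝ)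
      fun z => if t ≤ z then z else 0
    rw [h2] at h
    exact h.symm
  have h1 : t * (1 - ∫ z, (if |z| < t then (1 : ℝ) else 0) ∂gaussianReal 0 1) =
      ∫ z, t * (1 - if |z| < t then (1 : ℝ) else 0) ∂gaussianReal 0 1 := by
    rw [integral_const_mul, integral_sub (integrable_const _) hq]
    simp
  rw [h1, two_mul]
  nth_rewrite 1 [← hsymm]
  rw [← integral_add hm' hm]
  refine integral_mono (((integrable_const _).sub hq).const_mul _) (hm'.add hm) fun z => ?_
  simp only
  rcases abs_cases z with ⟨h, _⟩ | ⟨h, _⟩ <;> rw [h] <;> split_ifs <;> linarith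

open Classical in
/-- A lower bound for the two-sided Gaussian tail. -/
theorem exp_neg_sq_le_gaussian_tail (t : ℝ) :
    (√(2 * Real.pi))⁻¹ * Real.exp (-1) * Real.exp (-t ^ 2) ≤
      1 - ∫ z, (if |z| < t then (1 : ℝ) else 0) ∂gaussianReal 0 1 := by
  have hq := integrable_ite_abs_lt_gaussian t
  have h1 : 1 - ∫ z, (if |z| < t then (1 : ℝ) else 0) ∂gaussianReal 0 1 =
      ∫ z, (1 - if |z| < t then (1 : ℝ) else 0) ∂gaussianReal 0 1 := by
    rw [integral_sub (integrable_const _) hq]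
    simp
  have hK : ∀ z ∈ Set.Icc t (t + 1), (√(2 * Real.pi))⁻¹ * Real.exp (-1) * Real.exp (-t ^ 2) ≤
      gaussianPDFReal 0 1 z := by
    intro z hz
    rw [gaussianPDFReal, mul_assoc, ← Real.exp_add]
    simp only [NNReal.coe_one, mul_one, sub_zero]
    gcongr
    -- At the endpoint `t + 1` this is `(t + 1)² / 2 ≤ t² + 1`, that is, `(t - 1)² ≥ 0`.
    nlinarith [hz.1, hz.2, sq_nonneg (t - 1)]
  have h2 : (gaussianReal 0 1).real (Set.Icc t (t + 1)) ≤
      ∫ z, (1 - if |z| < t then (1 : ℝ) else 0) ∂gaussianReal 0 1 := by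
    rw [← integral_indicator_one measurableSet_Icc]
    refine integral_mono ((integrable_const (1 : ℝ)).indicator measurableSet_Icc)
      ((integrable_const _).sub hq) fun z => ?_
    by_cases hz : z ∈ Set.Icc t (t + 1)
    · have : ¬ |z| < t := not_lt.2 (hz.1.trans (le_abs_self z))
      simp [hz, this]
    · simp only [Set.indicator_of_notMem hz]
      split_ifs <;> norm_num
  rw [h1]
  refine le_trans ?_ h2
  rw [measureReal_def, gaussianReal_apply_eq_integral 0 one_ne_zero,
    ENNReal.toReal_ofReal (integral_nonneg fun z => gaussianPDFReal_nonneg _ _ _)]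
  have h3 := setIntegral_mono_on (μ := volume) (s := Set.Icc t (t + 1))
    (integrableOn_const (C := (√(2 * Real.pi))⁻¹ * Real.exp (-1) * Real.exp (-t ^ 2))
      (by simp)) (integrable_gaussianPDFReal 0 1).integrableOn measurableSet_Icc hK
  simpa using h3

end LowerBound

/-! ### Assembling the lower bound -/

section WidthLowerBound

variable {d : ℕ} {X : Set (EuclideanSpace ℝ (Fin d))}

theorem exists_orthonormalBasis_large_inner {μ : Measure (EuclideanSpace ℝ (Fin d))}
    (hX : IsCompact X) (hμ : μ ∈ nonsingularDesigns X) (y₀ : EuclideanSpace ℝ (Fin d))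
    {n : ℕ} (hn : n + 1 ≤ d) :
    ∃ (b : OrthonormalBasis (Fin d) ℝ (EuclideanSpace ℝ (Fin d)))
      (x : Fin d → EuclideanSpace ℝ (Fin d)), ∀ i : Fin d, (i : ℕ) < n → x i ∈ X ∧
        √((d : ℝ) - n) ≤ inner ℝ (invSqrt (designMatrix μ) (x i) - y₀) (b i) := by
  obtain ⟨hp, hae, hA⟩ := hμ
  obtain ⟨e, y, he, h0, hy⟩ := exists_orthonormal_large_inner
    (Y := invSqrt (designMatrix μ) '' X) (fun V => by
      obtain ⟨x, hx, h⟩ := exists_finrank_le_norm_sq_starProjection hX hae hA V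
      exact ⟨_, ⟨x, hx, rfl⟩, h⟩) y₀ hn
  have horth : Orthonormal ℝ (({i : Fin d | (i : ℕ) < n}).domRestrict fun i : Fin d => e i) := by
    rw [orthonormal_iff_ite]
    intro i j
    refine (he i.1 i.2 j.1 j.2).trans ?_
    simp only [Subtype.ext_iff, Fin.ext_iff]
  obtain ⟨b, hb⟩ := horth.exists_orthonormalBasis_extension_of_card_eq (by simp)
  choose! x hx using fun i hi => (hy i hi).1
  refine ⟨b, fun i => x i, fun i hi => ⟨(hx i hi).1, ?_⟩⟩
  -- Orthogonality of `y₀` to the directions makes subtracting it free.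
  rw [(hx i hi).2, hb i hi, inner_sub_left, h0 i hi, sub_zero]
  refine le_trans (Real.sqrt_le_sqrt ?_) (hy i hi).2
  have : ((i : ℕ) : ℝ) + 1 ≤ n := by exact_mod_cast hi
  linarith

open Classical in
theorem sqrt_mul_geom_sum_le_gaussianWidthAt {μ : Measure (EuclideanSpace ℝ (Fin d))}
    (hX : IsCompact X) (hne : X.Nonempty) (hμ : μ ∈ nonsingularDesigns X)
    {n : ℕ} (hn : n + 1 ≤ d) {t : ℝ} (ht : 0 ≤ t) :
    √((d : ℝ) - n) * (∫ z, (if t ≤ z then z else 0) ∂gaussianReal 0 1) *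
      ∑ i ∈ Finset.range n, (∫ z, (if |z| < t then (1 : ℝ) else 0) ∂gaussianReal 0 1) ^ i ≤
      gaussianWidthAt X (designMatrix μ) := by
  obtain ⟨x₀, hx₀⟩ := hne
  obtain ⟨b, x, hx⟩ := exists_orthonormalBasis_large_inner hX hμ
    (invSqrt (designMatrix μ) x₀) hn
  have h := le_integral_of_inner_le b (integrable_supProcess hX ⟨x₀, hx₀⟩ (designMatrix μ))
    (S := Finset.univ.filter fun i : Fin d => (i : ℕ) < n)
    (fun g => inner_le_supProcess hX _ g hx₀)
    (fun i hi g => inner_le_supProcess hX _ g (hx i (Finset.mem_filter.1 hi).2).1) t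
  refine le_trans ?_ h
  have hsum : ∀ f : ℕ → ℝ, ∑ i ∈ Finset.range n, f i =
      ∑ i ∈ Finset.univ.filter (fun i : Fin d => (i : ℕ) < n), f i := fun f => by
    rw [Finset.sum_filter, Fin.sum_univ_eq_sum_range (fun i => if i < n then f i else 0),
      ← Finset.sum_filter]
    congr 1
    ext i
    simp only [Finset.mem_range, Finset.mem_filter]
    omega
  rw [hsum, Finset.mul_sum]
  refine Finset.sum_le_sum fun i hi => ?_
  rw [integral_firstExceed_mul_coord_self, mul_assoc]
  refine mul_le_mul_of_nonneg_right (hx i (Finset.mem_filter.1 hi).2).2 (mul_nonneg ?_ ?_)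
  · refine integral_nonneg fun z => ?_
    simp only [Pi.zero_apply]
    split_ifs <;> linarith
  · refine pow_nonneg (integral_nonneg fun z => ?_) _
    simp only [Pi.zero_apply]
    split_ifs <;> norm_num

open Classical in
theorem sqrt_mul_log_le_gaussianWidth (hd : 1 ≤ d) (hX : IsCompact X) (hne : X.Nonempty) :
    (((1 - Real.exp (-((√(2 * Real.pi))⁻¹ * Real.exp (-1) / 3))) / (2 * √2) *
      √((d : ℝ) * Real.log d) : ℝ) : EReal) ≤ gaussianWidth X := by
  refine le_iInf₂ fun μ hμ => EReal.coe_le_coe_iff.2 ?_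
  set κ : ℝ := (√(2 * Real.pi))⁻¹ * Real.exp (-1) with hκ
  have hκ0 : 0 < κ := by positivity
  have hd' : (1 : ℝ) ≤ d := by exact_mod_cast hd
  have hlog : 0 ≤ Real.log d := Real.log_natCast_nonneg d
  -- With this `t` the tail bound reads `1 - q ≥ κ / d`, and about `d / 2` steps leave `√(d - n)` of
  -- order `√d`.
  set t := √(Real.log d) with ht
  have ht0 : 0 ≤ t := Real.sqrt_nonneg _
  set n := d / 2 with hn
  have hnd : n + 1 ≤ d := by omega
  have h := sqrt_mul_geom_sum_le_gaussianWidthAt hX hne hμ hnd ht0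
  have htail := mul_one_sub_le_two_mul_integral_tail ht0
  have hq := exp_neg_sq_le_gaussian_tail t
  set m := ∫ z, (if t ≤ z then z else 0) ∂gaussianReal 0 1
  set q := ∫ z, (if |z| < t then (1 : ℝ) else 0) ∂gaussianReal 0 1 with hqdef
  have hq0 : 0 ≤ q := integral_nonneg fun z => by
    simp only [Pi.zero_apply]
    split_ifs <;> norm_num
  have hexp : Real.exp (-t ^ 2) = (d : ℝ)⁻¹ := by
    rw [ht, Real.sq_sqrt hlog, Real.exp_neg, Real.exp_log (by linarith)]
  rw [← hκ, hexp] at hq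
  refine le_trans ?_ h
  rcases hd.eq_or_lt with rfl | hd2
  -- For `d = 1` both sides vanish: `log 1 = 0` and `n = 0`.
  · simp [hn]
  have hn3 : (d : ℝ) / 3 ≤ n := by
    have : d ≤ 3 * n := by omega
    have : (d : ℝ) ≤ 3 * n := by exact_mod_cast this
    linarith
  have hn2 : (d : ℝ) / 2 ≤ d - n := by
    have : 2 * n ≤ d := by omega
    have : 2 * (n : ℝ) ≤ d := by exact_mod_cast this
    linarith
  have hqn : q ^ n ≤ Real.exp (-(κ / 3)) := by
    have h1 : q ≤ Real.exp (-(κ * (d : ℝ)⁻¹)) := by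
      have := Real.add_one_le_exp (-(κ * (d : ℝ)⁻¹))
      linarith
    calc q ^ n ≤ Real.exp (-(κ * (d : ℝ)⁻¹)) ^ n := by gcongr
      _ = Real.exp (-(κ * (d : ℝ)⁻¹ * n)) := by rw [← Real.exp_nat_mul]; congr 1; ring
      _ ≤ _ := by
        gcongr
        calc κ / 3 = κ * (d : ℝ)⁻¹ * (d / 3) := by field_simp
          _ ≤ _ := by gcongr
  set Q := ∑ i ∈ Finset.range n, q ^ i with hQ
  have hQ0 : 0 ≤ Q := Finset.sum_nonneg fun i _ => pow_nonneg hq0 i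
  have hgeom : (1 - q) * Q = 1 - q ^ n := mul_neg_geom_sum q n
  -- The factor `1 - q` in `m ≥ t * (1 - q) / 2` cancels the denominator of the geometric sum,
  -- leaving the stopping probability `1 - q ^ n`.
  have hmQ : t / 2 * (1 - Real.exp (-(κ / 3))) ≤ m * Q := by
    calc t / 2 * (1 - Real.exp (-(κ / 3))) ≤ t / 2 * (1 - q ^ n) := by gcongr
      _ = t * (1 - q) / 2 * Q := by rw [← hgeom]; ring
      _ ≤ m * Q := by gcongr; linarith
  have hnn : 0 ≤ t / 2 * (1 - Real.exp (-(κ / 3))) := by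
    have : Real.exp (-(κ / 3)) ≤ 1 := Real.exp_le_one_iff.2 (by linarith)
    exact mul_nonneg (by positivity) (by linarith)
  calc (1 - Real.exp (-(κ / 3))) / (2 * √2) * √((d : ℝ) * Real.log d)
      = √(d / 2) * (t / 2 * (1 - Real.exp (-(κ / 3)))) := by
        rw [Real.sqrt_mul (by linarith), Real.sqrt_div (by linarith), ht]
        ring
    _ ≤ √((d : ℝ) - n) * (m * Q) := by gcongr
    _ = _ := by ring

end WidthLowerBound

/-- Basic bounds on the Gaussian width of a compact spanning set, with absolute constants. -/
theorem mainTheorem6 :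
    ∃ c C C' : ℝ, 0 < c ∧ 0 < C ∧ 0 < C' ∧
      ∀ (d : ℕ), 1 ≤ d → ∀ (X : Set (EuclideanSpace ℝ (Fin d))),
        IsCompact X → Submodule.span ℝ X = ⊤ →
          ((c * √((d : ℝ) * Real.log d) : ℝ) : EReal) ≤ gaussianWidth X ∧
          gaussianWidth X ≤ ((C * (d : ℝ) : ℝ) : EReal) ∧
          (X.Finite →
            gaussianWidth X ≤ ((C' * √((d : ℝ) * Real.log (X.ncard : ℝ)) : ℝ) : EReal)) := by
  have hκ : 0 < (√(2 * Real.pi))⁻¹ * Real.exp (-1) / 3 := by positivity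
  refine ⟨_, √8, 5, div_pos (sub_pos.2 (Real.exp_lt_one_iff.2 (neg_lt_zero.2 hκ))) (by positivity),
    by positivity, by norm_num, fun d hd X hX hspan => ⟨sqrt_mul_log_le_gaussianWidth hd hX
      (nonempty_of_span_eq_top hd hspan), gaussianWidth_le_mul hd hX hspan,
      fun hfin => gaussianWidth_le_sqrt_log hd hfin hspan⟩⟩
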